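/- Let $N\in\mathbb R$ and $\delta_0<1$. There is a constant $C$, depending only on $N$ and $\delta_0$, such that the following holds. Let $f:\mathbb R\to\mathbb R$ be an odd function which equals its Taylor series at $0$ on all of $\mathbb R$, i.e. $f(x)=\sum_{k\ge 0}\frac{f^{(k)}(0)}{k!}x^k$ for every $x$, and whose derivatives at zero satisfy $|f^{(k)}(0)|\le N$ for all $k\ge 0$. Put $$F_1(x)=\sum_{u\ge 0}\frac{f^{(2u+1)}(0)}{u!}\,x^u,\qquad \lambda=F_1(1/2)^2 ,$$ where the series for $F_1(1/2)$ converges; $\lambda$ depends only on $f$. Let $d\ge 0$ be an integer and let $X=(X_1,\dots,X_d)$ be a random vector with law $\mathcal N(0,\Sigma)$, where $\Sigma=(\sigma_{ij})$ is a positive definite $d\times d$ matrix whose inverse (the precision matrix) is $\Sigma^{-1}=I+B$ with $B_{ii}=0$ for all $i$ and $\|B\|\le\delta\le\delta_0$ (operator norm with respect to the Euclidean norm). Put $\epsilon=\frac{\delta}{1-\delta}$. Let $Y_i=f(X_i)$. Then every $Y_i$ is square integrable and, with $\tau_{ij}=\operatorname{Cov}(Y_i,Y_j)$, for all $i\ne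 j$, $$\bigl|\tau_{ij}-\lambda\,\sigma_{ij}\bigr|\le C\,\epsilon^3 .$$ In particular $\tau_{ij}=\lambda\sigma_{ij}+O(\epsilon^3)$ for $i \neq j$, with $\lambda$ independent of $i$ and $j$ and with an implied constant that does not depend on the dimension, on $\Sigma$ or on $i,j$. -/

import Mathlib

open MeasureTheory ProbabilityTheory
open scoped Nat

/-- The function `F_k(x) = ∑_{u ≥ 0} f^{(2u+k)}(0) / u! * x^u` attached to `f`. -/
noncomputable def derivSeries (f : ℝ → ℝ) (k : ℕ) (x : ℝ) : ℝ :=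
  ∑' u : ℕ, iteratedDeriv (2 * u + k) f 0 / (u ! : ℝ) * x ^ u

/-- The operator norm of a real square matrix with respect to the Euclidean norm. -/
noncomputable def euclideanOpNorm {d : ℕ} (B : Matrix (Fin d) (Fin d) ℝ) : ℝ :=
  ‖Matrix.toEuclideanCLM (n := Fin d) (𝕜 := ℝ) B‖

/-- The covariance matrix `τ` of the random vector `Y` with `Y_i = f (X_i)`. -/
noncomputable def transformedCov {Ω : Type*} [MeasurableSpace Ω] {d : ℕ} (P : Measure Ω)
    (X : Ω → EuclideanSpace ℝ (Fin d)) (f : ℝ → ℝ) : Matrix (Fin d) (Fin d) ℝ :=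
  Matrix.of fun i j => cov[fun ω => f (X ω i), fun ω => f (X ω j); P]

/-! For a centred Gaussian pair with variances `a`, `b` and covariance `s`, expand `f(X) f(Y)` in
monomials and group the pairings of Isserlis' theorem by the number `k` of cross pairs. This gives
`E[f(X) f(Y)] = ∑ s^k / k! * F_k(a/2) * F_k(b/2)` (`hasSum_covariance_pow`). Oddness makes `F_k`
vanish for even `k`, so the expectation is `s * F_1(a/2) * F_1(b/2) + O(s^3)`.

Since `S = 1 - S * B`, off-diagonal entries of `S` are at most `ε`; since also `S = 1 - B + S * B *
B` and `B` has zero diagonal, the variances are within `ε ^ 2` of one. As `F_1` is Lipschitz,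
replacing both arguments by `1/2` costs `|s| * O(ε ^ 2) = O(ε ^ 3)`. Only entrywise bounds by the
operator norm enter, hence no dependence on the dimension. -/

open Finset in
/-- Summing over the antidiagonals of `ℕ × ℕ`. -/
theorem HasSum.sum_antidiagonal {f : ℕ × ℕ → ℝ} {s : ℝ} (hf : HasSum f s) :
    HasSum (fun n => ∑ p ∈ antidiagonal n, f p) s := by
  refine ((HasAntidiagonal.sigmaAntidiagonalEquivProd (A := ℕ)).hasSum_iff.2 hf).sigma
    fun n => ?_
  exact (antidiagonal n).hasSum f

open Finset in
/-- The binomial theorem for divided powers. -/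
theorem add_pow_div_factorial (x y : ℝ) (n : ℕ) :
    (x + y) ^ n / (n ! : ℝ) =
      ∑ p ∈ antidiagonal n, x ^ p.1 / (p.1 ! : ℝ) * (y ^ p.2 / (p.2 ! : ℝ)) := by
  rw [(Commute.all x y).add_pow', sum_div]
  refine sum_congr rfl fun p hp => ?_
  obtain rfl := mem_antidiagonal.1 hp
  have h : ((p.1 + p.2).choose p.1 : ℝ) * (p.1 ! : ℝ) * (p.2 ! : ℝ) = ((p.1 + p.2)! : ℝ) := by
    rw [← Nat.add_choose_mul_factorial_mul_factorial p.1 p.2, Nat.choose_symm_add]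
    push_cast
    ring
  have h1 : (p.1 ! : ℝ) ≠ 0 := by positivity
  have h2 : (p.2 ! : ℝ) ≠ 0 := by positivity
  have h3 : ((p.1 + p.2)! : ℝ) ≠ 0 := by positivity
  rw [nsmul_eq_mul]
  field_simp
  rw [← h]
  ring

/-- Two finite sums of monomials in `t` that agree as functions have the same value under every
linear functional on polynomials. -/
theorem sum_mul_comp_eq_of_forall_sum_mul_pow_eq {ι κ : Type*} (A : Finset ι) (B : Finset κ)
    (a : ι → ℝ) (b : κ → ℝ) (e : ι → ℕ) (e' : κ → ℕ)
    (h : ∀ t : ℝ, ∑ i ∈ A, a i * t ^ e i = ∑ j ∈ B, b j * t ^ e' j) (g : ℕ → ℝ) :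
    ∑ i ∈ A, a i * g (e i) = ∑ j ∈ B, b j * g (e' j) := by
  have hp : ∑ i ∈ A, Polynomial.monomial (e i) (a i) =
      ∑ j ∈ B, Polynomial.monomial (e' j) (b j) := by
    refine Polynomial.funext fun t => ?_
    simpa [Polynomial.eval_finsetSum] using h t
  have hL : ∀ (n : ℕ) (r : ℝ), (Polynomial.basisMonomials ℝ).constr ℝ g
      (Polynomial.monomial n r) = r * g n := by
    intro n r
    have := (Polynomial.basisMonomials ℝ).constr_basis ℝ g n
    rw [Polynomial.coe_basisMonomials] at this
    rw [← mul_one r, ← smul_eq_mul r 1, ← Polynomial.smul_monomial, map_smul, this]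
    simp
  have := congrArg ((Polynomial.basisMonomials ℝ).constr ℝ g) hp
  simpa only [map_sum, hL] using this

/-! ### Moments of one Gaussian variable. -/

/-- With `M' = v * t * M`, Leibniz at `0` keeps only the term that differentiates the factor `t`
exactly once. -/
theorem iteratedDeriv_exp_mul_sq_succ_succ (v : ℝ) (n : ℕ) :
    iteratedDeriv (n + 2) (fun t : ℝ => Real.exp (v * t ^ 2 / 2)) 0 =
      v * (n + 1) * iteratedDeriv n (fun t : ℝ => Real.exp (v * t ^ 2 / 2)) 0 := by
  set M : ℝ → ℝ := fun t => Real.exp (v * t ^ 2 / 2) with hM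
  have hMs : ContDiff ℝ ⊤ M := by fun_prop
  have hd : deriv M = fun t => t * (v * M t) := by
    funext t
    have h1 : HasDerivAt (fun t : ℝ => v * t ^ 2 / 2) (v * t) t := by
      have := ((hasDerivAt_pow 2 t).const_mul v).div_const 2
      convert! this using 1
      simp; ring
    rw [hM, h1.exp.deriv]
    ring
  have hv : ∀ m, iteratedDeriv m (fun t => v * M t) 0 = v * iteratedDeriv m M 0 := by
    intro m
    rw [iteratedDeriv_const_mul_field]
  rw [iteratedDeriv_succ', hd, iteratedDeriv_fun_mul (by fun_prop) (by fun_prop)]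
  rw [Finset.sum_range_succ', Finset.sum_range_succ']
  simp [iteratedDeriv_fun_id, hv]
  ring

/-- The even moments of a centered real Gaussian. -/
theorem integral_pow_two_mul_of_hasLaw_gaussianReal {Ω : Type*} [MeasurableSpace Ω]
    {P : Measure Ω} {W : Ω → ℝ} {v : NNReal} (hW : HasLaw W (gaussianReal 0 v) P) (r : ℕ) :
    ∫ ω, W ω ^ (2 * r) ∂P = ((2 * r)! : ℝ) * ((v / 2 : ℝ) ^ r / (r ! : ℝ)) := by
  have h0 : ∫ ω, W ω ^ (2 * r) ∂P = ∫ x, (id x) ^ (2 * r) ∂(gaussianReal 0 v) :=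
    hW.integral_comp (f := fun x : ℝ => x ^ (2 * r)) (by fun_prop)
  have h1 := iteratedDeriv_mgf_zero (X := (id : ℝ → ℝ)) (μ := gaussianReal 0 v) (by simp) (2 * r)
  simp only [mgf_id_gaussianReal, zero_mul, zero_add, Pi.pow_apply] at h1
  rw [h0, ← h1]
  clear h0 h1
  induction r with
  | zero => simp
  | succ r ih =>
    rw [mul_add, mul_one, iteratedDeriv_exp_mul_sq_succ_succ, ih, Nat.factorial_succ (2 * r + 1),
      Nat.factorial_succ (2 * r), Nat.factorial_succ r]
    have h1 : (r ! : ℝ) ≠ 0 := by positivity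
    push_cast
    field_simp
    ring

/-! ### Gaussian pairs and Isserlis' theorem. -/

/-- Every linear combination of `X` and `Y` is a centered Gaussian, where `X` and `Y` have
variances `a`, `b` and covariance `s`. -/
structure IsCenteredGaussianPair {Ω : Type*} [MeasurableSpace Ω] (P : Measure Ω) (X Y : Ω → ℝ)
    (a b s : ℝ) : Prop where
  var_nonneg : ∀ t u : ℝ, 0 ≤ t ^ 2 * a + 2 * t * u * s + u ^ 2 * b
  hasLaw : ∀ t u : ℝ, HasLaw (fun ω => t * X ω + u * Y ω)
    (gaussianReal 0 (t ^ 2 * a + 2 * t * u * s + u ^ 2 * b).toNNReal) P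

section Gaussian

variable {Ω : Type*} [MeasurableSpace Ω] {P : Measure Ω} {X Y : Ω → ℝ} {a b s : ℝ}

theorem integrable_exp_mul_abs_of_hasLaw_gaussianReal {v : NNReal}
    (hX : HasLaw X (gaussianReal 0 v) P) (t : ℝ) :
    Integrable (fun ω => Real.exp (t * |X ω|)) P := by
  have h : ∀ u : ℝ, Integrable (fun ω => Real.exp (u * X ω)) P := by
    intro u
    have h1 := integrable_exp_mul_gaussianReal (μ := 0) (v := v) u
    rw [← hX.map_eq] at h1
    exact h1.comp_aemeasurable hX.aemeasurable
  exact integrable_exp_mul_abs (h t) (h (-t))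

namespace IsCenteredGaussianPair

theorem hasLaw_left (h : IsCenteredGaussianPair P X Y a b s) :
    HasLaw X (gaussianReal 0 a.toNNReal) P := by
  simpa using h.hasLaw 1 0

theorem hasLaw_right (h : IsCenteredGaussianPair P X Y a b s) :
    HasLaw Y (gaussianReal 0 b.toNNReal) P := by
  simpa using h.hasLaw 0 1

/-- By AM-GM the marginals suffice; no joint density is needed, so degenerate pairs are allowed. -/
theorem integrable_exp_abs_add_abs (h : IsCenteredGaussianPair P X Y a b s) :
    Integrable (fun ω => Real.exp (|X ω| + |Y ω|)) P := by
  have hX := integrable_exp_mul_abs_of_hasLaw_gaussianReal h.hasLaw_left 2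
  have hY := integrable_exp_mul_abs_of_hasLaw_gaussianReal h.hasLaw_right 2
  have mX := h.hasLaw_left.aemeasurable
  have mY := h.hasLaw_right.aemeasurable
  refine (hX.add hY).mono' (AEMeasurable.aestronglyMeasurable (by fun_prop))
    (ae_of_all _ fun ω => ?_)
  have e1 : Real.exp (2 * |X ω|) = Real.exp |X ω| ^ 2 := by
    rw [← Real.exp_nat_mul]; norm_num
  have e2 : Real.exp (2 * |Y ω|) = Real.exp |Y ω| ^ 2 := by
    rw [← Real.exp_nat_mul]; norm_num
  rw [Real.norm_of_nonneg (Real.exp_pos _).le]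
  simp only [Pi.add_apply, e1, e2, Real.exp_add]
  nlinarith [sq_nonneg (Real.exp |X ω| - Real.exp |Y ω|), Real.exp_pos |X ω|, Real.exp_pos |Y ω|]

theorem integrable_pow_mul_pow (h : IsCenteredGaussianPair P X Y a b s) (m n : ℕ) :
    Integrable (fun ω => X ω ^ m * Y ω ^ n) P := by
  have mX := h.hasLaw_left.aemeasurable
  have mY := h.hasLaw_right.aemeasurable
  refine (h.integrable_exp_abs_add_abs.const_mul ((m ! : ℝ) * (n ! : ℝ))).mono'
    (AEMeasurable.aestronglyMeasurable (by fun_prop)) (ae_of_all _ fun ω => ?_)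
  have h1 := Real.pow_div_factorial_le_exp _ (abs_nonneg (X ω)) m
  have h2 := Real.pow_div_factorial_le_exp _ (abs_nonneg (Y ω)) n
  rw [div_le_iff₀ (by positivity)] at h1 h2
  rw [norm_mul, norm_pow, norm_pow, Real.norm_eq_abs, Real.norm_eq_abs, Real.exp_add]
  calc _ ≤ (Real.exp |X ω| * (m ! : ℝ)) * (Real.exp |Y ω| * (n ! : ℝ)) := by gcongr
    _ = _ := by ring

open Finset in
/-- The generating polynomial of the mixed moments of total degree `2 * r`. -/
theorem sum_integral_mul_pow (h : IsCenteredGaussianPair P X Y a b s) (r : ℕ) (t : ℝ) :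
    ∑ p ∈ antidiagonal (2 * r),
      (∫ ω, X ω ^ p.1 * Y ω ^ p.2 ∂P) / ((p.1 ! : ℝ) * (p.2 ! : ℝ)) * t ^ p.1 =
    ∑ x ∈ (antidiagonal r).sigma fun p => antidiagonal p.2,
      (s ^ x.1.1 / (x.1.1 ! : ℝ) * ((a / 2) ^ x.2.1 / (x.2.1 ! : ℝ) *
        ((b / 2) ^ x.2.2 / (x.2.2 ! : ℝ)))) * t ^ (2 * x.2.1 + x.1.1) := by
  have h1 := integral_pow_two_mul_of_hasLaw_gaussianReal (h.hasLaw t 1) r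
  rw [Real.coe_toNNReal _ (h.var_nonneg t 1)] at h1
  have h2 : ∀ ω, (t * X ω + 1 * Y ω) ^ (2 * r) = ((2 * r)! : ℝ) * ∑ p ∈ antidiagonal (2 * r),
      (X ω ^ p.1 * Y ω ^ p.2) / ((p.1 ! : ℝ) * (p.2 ! : ℝ)) * t ^ p.1 := by
    intro ω
    have h3 := add_pow_div_factorial (t * X ω) (1 * Y ω) (2 * r)
    rw [div_eq_iff (by positivity)] at h3
    rw [h3, mul_comm]
    congr 1
    refine sum_congr rfl fun p _ => ?_
    rw [one_mul, mul_pow]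
    field_simp
  simp only [h2] at h1
  rw [integral_const_mul, mul_right_inj' (by positivity), integral_finsetSum _ fun p _ =>
    (((h.integrable_pow_mul_pow p.1 p.2).div_const _).mul_const _)] at h1
  simp only [integral_mul_const, integral_div] at h1
  rw [h1, sum_sigma,
    show (t ^ 2 * a + 2 * t * 1 * s + 1 ^ 2 * b) / 2 = s * t + (a / 2 * t ^ 2 + b / 2) by ring,
    add_pow_div_factorial]
  refine sum_congr rfl fun p _ => ?_
  rw [add_pow_div_factorial, mul_sum]
  refine sum_congr rfl fun q _ => ?_
  dsimp only
  rw [mul_pow, mul_pow, pow_add, pow_mul]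
  ring

open Finset in
/-- Isserlis' theorem for two variables, summed against a coefficient sequence. -/
theorem sum_mul_integral_pow_mul_pow (h : IsCenteredGaussianPair P X Y a b s) (c : ℕ → ℝ) (r : ℕ) :
    ∑ p ∈ antidiagonal (2 * r), c p.1 / (p.1 ! : ℝ) * (c p.2 / (p.2 ! : ℝ)) *
      (∫ ω, X ω ^ p.1 * Y ω ^ p.2 ∂P) =
    ∑ p ∈ antidiagonal r, s ^ p.1 / (p.1 ! : ℝ) * ∑ q ∈ antidiagonal p.2,
      c (2 * q.1 + p.1) / (q.1 ! : ℝ) * (a / 2) ^ q.1 *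
        (c (2 * q.2 + p.1) / (q.2 ! : ℝ) * (b / 2) ^ q.2) := by
  -- Applying the functional `t ^ m ↦ c m * c (2 * r - m)` to the generating polynomial inserts the
  -- coefficients of `f`.
  have h1 := sum_mul_comp_eq_of_forall_sum_mul_pow_eq _ _ _ _ _ _
    (h.sum_integral_mul_pow r) fun m => c m * c (2 * r - m)
  rw [sum_sigma] at h1
  convert! h1 using 1
  · refine sum_congr rfl fun p hp => ?_
    have : 2 * r - p.1 = p.2 := by have := mem_antidiagonal.1 hp; omega
    rw [this]
    field_simp
  · refine sum_congr rfl fun p hp => ?_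
    rw [mul_sum]
    refine sum_congr rfl fun q hq => ?_
    have : 2 * r - (2 * q.1 + p.1) = 2 * q.2 + p.1 := by
      have := mem_antidiagonal.1 hp
      have := mem_antidiagonal.1 hq
      omega
    dsimp only
    rw [this]
    ring

end IsCenteredGaussianPair

end Gaussian

/-! ### Bounds for the series `F_k`. -/

/-- The series `∑ u, c (2 * u + k) / u! * x ^ u`. -/
noncomputable def evenStepSeries (c : ℕ → ℝ) (k : ℕ) (x : ℝ) : ℝ :=
  ∑' u : ℕ, c (2 * u + k) / (u ! : ℝ) * x ^ u

theorem Real.hasSum_pow_div_factorial (x : ℝ) :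
    HasSum (fun n : ℕ => x ^ n / (n ! : ℝ)) (Real.exp x) := by
  rw [Real.exp_eq_exp_ℝ]
  exact NormedSpace.expSeries_div_hasSum_exp x

section Coefficients

variable {c : ℕ → ℝ} {N : ℝ}

theorem norm_coeff_div_factorial_mul_pow_le (hc : ∀ k, |c k| ≤ N) (g : ℕ → ℕ) (x : ℝ) (u : ℕ) :
    ‖c (g u) / (u ! : ℝ) * x ^ u‖ ≤ N * (|x| ^ u / (u ! : ℝ)) := by
  rw [norm_mul, norm_div, norm_pow, Real.norm_natCast, Real.norm_eq_abs, Real.norm_eq_abs,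
    div_mul_eq_mul_div, ← mul_div_assoc]
  gcongr
  exact hc _

theorem summable_norm_coeff_div_factorial_mul_pow (hc : ∀ k, |c k| ≤ N) (g : ℕ → ℕ) (x : ℝ) :
    Summable fun u : ℕ => ‖c (g u) / (u ! : ℝ) * x ^ u‖ :=
  Summable.of_nonneg_of_le (fun _ => norm_nonneg _) (norm_coeff_div_factorial_mul_pow_le hc g x)
    ((Real.summable_pow_div_factorial _).mul_left N)

theorem norm_evenStepSeries_le (hc : ∀ k, |c k| ≤ N) (k : ℕ) (x : ℝ) :
    ‖evenStepSeries c k x‖ ≤ N * Real.exp |x| :=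
  tsum_of_norm_bounded ((Real.hasSum_pow_div_factorial _).mul_left N)
    (norm_coeff_div_factorial_mul_pow_le hc (fun u => 2 * u + k) x)

/-- The constant terms cancel, and the factor `u + 1` from the difference of powers is absorbed by
`(u + 1)!`, leaving an exponential series. -/
theorem norm_evenStepSeries_sub_le (hc : ∀ k, |c k| ≤ N) (k : ℕ) {x y K : ℝ} (hx : |x| ≤ K)
    (hy : |y| ≤ K) :
    ‖evenStepSeries c k x - evenStepSeries c k y‖ ≤ N * |x - y| * Real.exp K := by
  have hs :=
    ((summable_norm_coeff_div_factorial_mul_pow hc (fun u => 2 * u + k) x).of_norm.hasSum).sub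
    ((summable_norm_coeff_div_factorial_mul_pow hc (fun u => 2 * u + k) y).of_norm.hasSum)
  have hs' := (hasSum_nat_add_iff' 1).2 hs
  simp only [Finset.range_one, Finset.sum_singleton, pow_zero, sub_self, sub_zero] at hs'
  unfold evenStepSeries
  refine hs'.norm_le_of_bounded ((Real.hasSum_pow_div_factorial K).mul_left (N * |x - y|))
    fun u => ?_
  have hN : 0 ≤ N := (abs_nonneg _).trans (hc 0)
  have hK : 0 ≤ K := (abs_nonneg _).trans hx
  have h1 : |x ^ (u + 1) - y ^ (u + 1)| ≤ |x - y| * (u + 1) * K ^ u := by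
    refine (abs_pow_sub_pow_le x y (u + 1)).trans ?_
    simp only [Nat.cast_add, Nat.cast_one, Nat.add_sub_cancel]
    gcongr
    exact max_le hx hy
  rw [← mul_sub, norm_mul, norm_div, Real.norm_natCast, Real.norm_eq_abs, Real.norm_eq_abs,
    Nat.factorial_succ]
  push_cast
  calc |c (2 * (u + 1) + k)| / (((u : ℝ) + 1) * (u ! : ℝ)) * |x ^ (u + 1) - y ^ (u + 1)|
      ≤ N / (((u : ℝ) + 1) * (u ! : ℝ)) * (|x - y| * (u + 1) * K ^ u) := by
        gcongr
        exact hc _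
    _ = N * |x - y| * (K ^ u / (u ! : ℝ)) := by
        field_simp

end Coefficients

/-! ### Expansion of the expectation in powers of the covariance. -/

section Expectation

variable {Ω : Type*} [MeasurableSpace Ω] {P : Measure Ω} {X Y : Ω → ℝ} {a b s N : ℝ}
  {c : ℕ → ℝ} {f : ℝ → ℝ}

theorem measurable_of_hasSum_pow (hf : ∀ x, HasSum (fun k : ℕ => c k / (k ! : ℝ) * x ^ k) (f x)) :
    Measurable f := by
  refine measurable_of_tendsto_metrizable
    (f := fun n x => ∑ k ∈ Finset.range n, c k / (k ! : ℝ) * x ^ k) (fun n => by fun_prop) ?_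
  rw [tendsto_pi_nhds]
  exact fun x => (hf x).tendsto_sum_nat

theorem abs_le_mul_exp_abs_of_hasSum_pow (hc : ∀ k, |c k| ≤ N)
    (hf : ∀ x, HasSum (fun k : ℕ => c k / (k ! : ℝ) * x ^ k) (f x)) (x : ℝ) :
    |f x| ≤ N * Real.exp |x| :=
  (hf x).norm_le_of_bounded ((Real.hasSum_pow_div_factorial |x|).mul_left N)
    (norm_coeff_div_factorial_mul_pow_le hc (fun u => u) x)

open Finset in
theorem hasSum_antidiagonal_mul
    (hf : ∀ x, HasSum (fun k : ℕ => c k / (k ! : ℝ) * x ^ k) (f x)) (x y : ℝ) :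
    HasSum (fun n => ∑ p ∈ antidiagonal n, c p.1 / (p.1 ! : ℝ) * (c p.2 / (p.2 ! : ℝ)) *
      (x ^ p.1 * y ^ p.2)) (f x * f y) := by
  have hs := summable_mul_of_summable_norm (hf x).summable.norm (hf y).summable.norm
  have h := (hf x).mul (hf y) hs
  convert! h.sum_antidiagonal using 3 with n p
  ring

open Finset in
theorem norm_sum_antidiagonal_mul_le (hc : ∀ k, |c k| ≤ N) (x y : ℝ) (n : ℕ) :
    ‖∑ p ∈ antidiagonal n, c p.1 / (p.1 ! : ℝ) * (c p.2 / (p.2 ! : ℝ)) * (x ^ p.1 * y ^ p.2)‖ ≤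
      N ^ 2 * ((|x| + |y|) ^ n / (n ! : ℝ)) := by
  have hN : 0 ≤ N := (abs_nonneg _).trans (hc 0)
  rw [add_pow_div_factorial, mul_sum]
  refine norm_sum_le_of_le _ fun p _ => ?_
  have h1 := norm_coeff_div_factorial_mul_pow_le hc (fun u => u) x p.1
  have h2 := norm_coeff_div_factorial_mul_pow_le hc (fun u => u) y p.2
  calc _ = ‖c p.1 / (p.1 ! : ℝ) * x ^ p.1‖ * ‖c p.2 / (p.2 ! : ℝ) * y ^ p.2‖ := by
        rw [← norm_mul]; ring_nf
    _ ≤ (N * (|x| ^ p.1 / (p.1 ! : ℝ))) * (N * (|y| ^ p.2 / (p.2 ! : ℝ))) := by gcongr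
    _ = _ := by ring

open Finset in
theorem hasSum_antidiagonal_evenStepSeries_mul (hc : ∀ k, |c k| ≤ N) (k : ℕ) (x y : ℝ) :
    HasSum (fun n => ∑ q ∈ antidiagonal n, c (2 * q.1 + k) / (q.1 ! : ℝ) * x ^ q.1 *
      (c (2 * q.2 + k) / (q.2 ! : ℝ) * y ^ q.2)) (evenStepSeries c k x * evenStepSeries c k y) := by
  have hx := summable_norm_coeff_div_factorial_mul_pow hc (fun u => 2 * u + k) x
  have hy := summable_norm_coeff_div_factorial_mul_pow hc (fun u => 2 * u + k) y
  have hs := summable_mul_of_summable_norm hx hy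
  have h := hx.of_norm.hasSum.mul hy.of_norm.hasSum hs
  simpa only [evenStepSeries] using h.sum_antidiagonal

open Finset in
theorem norm_sum_antidiagonal_evenStep_le (hc : ∀ k, |c k| ≤ N) (k : ℕ) (x y : ℝ) (n : ℕ) :
    ‖∑ q ∈ antidiagonal n, c (2 * q.1 + k) / (q.1 ! : ℝ) * x ^ q.1 *
      (c (2 * q.2 + k) / (q.2 ! : ℝ) * y ^ q.2)‖ ≤ N ^ 2 * ((|x| + |y|) ^ n / (n ! : ℝ)) := by
  have hN : 0 ≤ N := (abs_nonneg _).trans (hc 0)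
  rw [add_pow_div_factorial, mul_sum]
  refine norm_sum_le_of_le _ fun q _ => ?_
  have h1 := norm_coeff_div_factorial_mul_pow_le hc (fun u => 2 * u + k) x q.1
  have h2 := norm_coeff_div_factorial_mul_pow_le hc (fun u => 2 * u + k) y q.2
  calc _ ≤ (N * (|x| ^ q.1 / (q.1 ! : ℝ))) * (N * (|y| ^ q.2 / (q.2 ! : ℝ))) := by
        rw [norm_mul]; gcongr
    _ = _ := by ring

namespace IsCenteredGaussianPair

-- Dominated convergence, with the terms bounded by those of the series for `N ^ 2 * exp (|X| +
-- |Y|)`.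
open Finset in
theorem hasSum_integral_mul (h : IsCenteredGaussianPair P X Y a b s) (hc : ∀ k, |c k| ≤ N)
    (hf : ∀ x, HasSum (fun k : ℕ => c k / (k ! : ℝ) * x ^ k) (f x)) :
    HasSum (fun n => ∑ p ∈ antidiagonal n, c p.1 / (p.1 ! : ℝ) * (c p.2 / (p.2 ! : ℝ)) *
      ∫ ω, X ω ^ p.1 * Y ω ^ p.2 ∂P) (∫ ω, f (X ω) * f (Y ω) ∂P) := by
  have mX := h.hasLaw_left.aemeasurable
  have mY := h.hasLaw_right.aemeasurable
  have hS : ∀ ω, HasSum (fun n : ℕ => N ^ 2 * ((|X ω| + |Y ω|) ^ n / (n ! : ℝ)))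
      (N ^ 2 * Real.exp (|X ω| + |Y ω|)) := fun ω =>
    (Real.hasSum_pow_div_factorial _).mul_left _
  have key := hasSum_integral_of_dominated_convergence (μ := P)
    (F := fun n ω => ∑ p ∈ antidiagonal n, c p.1 / (p.1 ! : ℝ) * (c p.2 / (p.2 ! : ℝ)) *
      (X ω ^ p.1 * Y ω ^ p.2)) (f := fun ω => f (X ω) * f (Y ω))
    (fun n ω => N ^ 2 * ((|X ω| + |Y ω|) ^ n / (n ! : ℝ)))
    (fun n => AEMeasurable.aestronglyMeasurable (by fun_prop))
    (fun n => ae_of_all _ fun ω => norm_sum_antidiagonal_mul_le hc _ _ n)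
    (ae_of_all _ fun ω => (hS ω).summable)
    (by simpa only [(hS _).tsum_eq] using h.integrable_exp_abs_add_abs.const_mul (N ^ 2))
    (ae_of_all _ fun ω => hasSum_antidiagonal_mul hf _ _)
  convert! key using 2 with n
  rw [integral_finsetSum _ fun p _ => (h.integrable_pow_mul_pow p.1 p.2).const_mul _]
  simp only [integral_const_mul]

open Finset in
/-- The expansion of `E[f(X) f(Y)]` in powers of the covariance. -/
theorem hasSum_covariance_pow (h : IsCenteredGaussianPair P X Y a b s) (hc : ∀ k, |c k| ≤ N)
    (hodd : ∀ k, c (2 * k) = 0)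
    (hf : ∀ x, HasSum (fun k : ℕ => c k / (k ! : ℝ) * x ^ k) (f x)) :
    HasSum (fun k => s ^ k / (k ! : ℝ) * (evenStepSeries c k (a / 2) * evenStepSeries c k (b / 2)))
      (∫ ω, f (X ω) * f (Y ω) ∂P) := by
  -- `p.1` counts cross pairs and `p.2` internal pairs. Antidiagonals collect total degree `2 * r`;
  -- rows collect a fixed power of `s`.
  obtain ⟨H, hH⟩ : ∃ H : ℕ × ℕ → ℝ, H = fun p => s ^ p.1 / (p.1 ! : ℝ) * ∑ q ∈ antidiagonal p.2,
      c (2 * q.1 + p.1) / (q.1 ! : ℝ) * (a / 2) ^ q.1 *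
        (c (2 * q.2 + p.1) / (q.2 ! : ℝ) * (b / 2) ^ q.2) := ⟨_, rfl⟩
  have hN : 0 ≤ N := (abs_nonneg _).trans (hc 0)
  have hHs : Summable H := by
    have h1 : Summable fun p : ℕ × ℕ => (|s| ^ p.1 / (p.1 ! : ℝ)) *
        (N ^ 2 * ((|a / 2| + |b / 2|) ^ p.2 / (p.2 ! : ℝ))) :=
      (Real.summable_pow_div_factorial |s|).mul_of_nonneg
        ((Real.summable_pow_div_factorial (|a / 2| + |b / 2|)).mul_left (N ^ 2))
        (fun n => by positivity) (fun n => by positivity)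
    refine Summable.of_norm_bounded h1 fun p => ?_
    simp only [hH]
    rw [norm_mul, norm_div, norm_pow, Real.norm_natCast, Real.norm_eq_abs]
    gcongr
    exact norm_sum_antidiagonal_evenStep_le hc _ _ _ _
  have hdiag : HasSum (fun r => ∑ p ∈ antidiagonal r, H p) (∫ ω, f (X ω) * f (Y ω) ∂P) := by
    have h2 := h.hasSum_integral_mul hc hf
    -- In odd total degree one of the two exponents is even, so its coefficient vanishes.
    rw [← (mul_right_injective₀ (two_ne_zero : (2 : ℕ) ≠ 0)).hasSum_iff] at h2
    · simpa only [hH, Function.comp_def, h.sum_mul_integral_pow_mul_pow c] using h2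
    · intro n hn
      have hn' : ¬ Even n := fun ⟨k, hk⟩ => hn ⟨k, by simp only; omega⟩
      refine sum_eq_zero fun p hp => ?_
      have hp' := mem_antidiagonal.1 hp
      rcases Nat.even_or_odd' p.1 with ⟨k, hk | hk⟩
      · rw [hk, hodd]; simp
      · rcases Nat.even_or_odd' p.2 with ⟨l, hl | hl⟩
        · rw [hl, hodd]; simp
        · exact (hn' ⟨k + l + 1, by omega⟩).elim
  have hT := hHs.hasSum
  rw [hT.sum_antidiagonal.unique hdiag] at hT
  refine hT.prod_fiberwise fun k => ?_
  simp only [hH]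
  exact (hasSum_antidiagonal_evenStepSeries_mul hc k _ _).mul_left _

open Finset in
/-- The expectation `E[f(X) f(Y)]` for odd `f`, up to third order in the covariance. -/
theorem abs_integral_mul_sub_le (h : IsCenteredGaussianPair P X Y a b s) (hc : ∀ k, |c k| ≤ N)
    (hodd : ∀ k, c (2 * k) = 0)
    (hf : ∀ x, HasSum (fun k : ℕ => c k / (k ! : ℝ) * x ^ k) (f x)) :
    |∫ ω, f (X ω) * f (Y ω) ∂P - s * (evenStepSeries c 1 (a / 2) * evenStepSeries c 1 (b / 2))| ≤
      |s| ^ 3 * (N * Real.exp |a / 2|) * (N * Real.exp |b / 2|) * Real.exp |s| := by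
  have h0 : ∀ k x, evenStepSeries c (2 * k) x = 0 := by
    intro k x
    simp only [evenStepSeries, ← mul_add, hodd, zero_div, zero_mul, tsum_zero]
  -- Of the three terms removed, those with `k = 0` and `k = 2` are zero.
  have hs := (hasSum_nat_add_iff' 3).2 (h.hasSum_covariance_pow hc hodd hf)
  have h00 := h0 0
  have h02 := h0 1
  simp only [mul_zero, mul_one] at h00 h02
  simp only [sum_range_succ, range_zero, sum_empty, h00, h02, mul_zero, zero_add, pow_one,
    Nat.factorial_one, Nat.cast_one, div_one, add_zero] at hs
  refine hs.norm_le_of_bounded ((Real.hasSum_pow_div_factorial |s|).mul_left _) fun k => ?_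
  have hN : 0 ≤ N := (abs_nonneg _).trans (hc 0)
  have h1 := norm_evenStepSeries_le hc (k + 3) (a / 2)
  have h2 := norm_evenStepSeries_le hc (k + 3) (b / 2)
  rw [norm_mul, norm_mul, norm_div, norm_pow, Real.norm_natCast, Real.norm_eq_abs s]
  calc |s| ^ (k + 3) / ((k + 3)! : ℝ) *
        (‖evenStepSeries c (k + 3) (a / 2)‖ * ‖evenStepSeries c (k + 3) (b / 2)‖)
      ≤ |s| ^ (k + 3) / (k ! : ℝ) * ((N * Real.exp |a / 2|) * (N * Real.exp |b / 2|)) := by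
        gcongr
        omega
    _ = _ := by rw [pow_add]; ring

end IsCenteredGaussianPair

theorem memLp_two_comp_of_hasLaw_gaussianReal {v : NNReal} (hX : HasLaw X (gaussianReal 0 v) P)
    (hc : ∀ k, |c k| ≤ N) (hf : ∀ x, HasSum (fun k : ℕ => c k / (k ! : ℝ) * x ^ k) (f x)) :
    MemLp (fun ω => f (X ω)) 2 P := by
  have mX := hX.aemeasurable
  have mf := measurable_of_hasSum_pow hf
  have m : AEStronglyMeasurable (fun ω => f (X ω)) P :=
    (mf.comp_aemeasurable mX).aestronglyMeasurable
  rw [memLp_two_iff_integrable_sq m]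
  refine ((integrable_exp_mul_abs_of_hasLaw_gaussianReal hX 2).const_mul (N ^ 2)).mono'
    (m.pow 2) (ae_of_all _ fun ω => ?_)
  rw [norm_pow, Real.norm_eq_abs]
  calc |f (X ω)| ^ 2 ≤ (N * Real.exp |X ω|) ^ 2 := by
        gcongr; exact abs_le_mul_exp_abs_of_hasSum_pow hc hf _
    _ = _ := by rw [mul_pow, ← Real.exp_nat_mul]; norm_num

theorem integral_odd_comp_of_hasLaw_gaussianReal {v : NNReal} (hX : HasLaw X (gaussianReal 0 v) P)
    (hm : Measurable f) (hodd : f.Odd) : ∫ ω, f (X ω) ∂P = 0 := by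
  have h1 : ∫ ω, f (X ω) ∂P = ∫ x, f x ∂(gaussianReal 0 v) :=
    hX.integral_comp hm.aestronglyMeasurable
  have h2 : ∫ ω, f (-X ω) ∂P = ∫ x, f x ∂(gaussianReal 0 v) := by
    have h3 : HasLaw (fun ω => -X ω) (gaussianReal 0 v) P := by
      have := gaussianReal_neg hX
      rwa [neg_zero] at this
    exact h3.integral_comp hm.aestronglyMeasurable
  simp only [hodd _, integral_neg] at h2
  linarith

end Expectation

/-! ### From the random vector to pairs of coordinates. -/

theorem isCenteredGaussianPair_of_hasLaw_multivariateGaussian {Ω : Type*} [MeasurableSpace Ω]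
    {P : Measure Ω} {d : ℕ} {S : Matrix (Fin d) (Fin d) ℝ} (hS : S.PosSemidef)
    {X : Ω → EuclideanSpace ℝ (Fin d)} (hX : HasLaw X (multivariateGaussian 0 S) P)
    (i j : Fin d) :
    IsCenteredGaussianPair P (fun ω => X ω i) (fun ω => X ω j) (S i i) (S j j) (S i j) := by
  have hm : ∀ i, MemLp (fun x : EuclideanSpace ℝ (Fin d) => x i) 2 (multivariateGaussian 0 S) :=
    fun i => IsGaussian.memLp_dual _ (EuclideanSpace.proj i : _ →L[ℝ] ℝ) 2 (by simp)
  have hvar : ∀ t u : ℝ, Var[fun x : EuclideanSpace ℝ (Fin d) => t * x i + u * x j;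
      multivariateGaussian 0 S] = t ^ 2 * S i i + 2 * t * u * S i j + u ^ 2 * S j j := by
    intro t u
    rw [variance_fun_add ((hm i).const_mul t) ((hm j).const_mul u), variance_const_mul,
      variance_const_mul, covariance_const_mul_left, covariance_const_mul_right,
      variance_eval_multivariateGaussian hS, variance_eval_multivariateGaussian hS,
      covariance_eval_multivariateGaussian hS]
    ring
  refine ⟨fun t u => hvar t u ▸ variance_nonneg _ _, fun t u => ?_⟩
  set L : EuclideanSpace ℝ (Fin d) →L[ℝ] ℝ :=
    t • EuclideanSpace.proj i + u • EuclideanSpace.proj j with hL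
  have hLx : (L : EuclideanSpace ℝ (Fin d) → ℝ) = fun x => t * x i + u * x j := by
    ext x; simp [hL]
  have hmap : HasLaw (fun x : EuclideanSpace ℝ (Fin d) => t * x i + u * x j)
      (gaussianReal 0 (t ^ 2 * S i i + 2 * t * u * S i j + u ^ 2 * S j j).toNNReal)
      (multivariateGaussian 0 S) := by
    refine ⟨by fun_prop, ?_⟩
    rw [← hvar, ← hLx, IsGaussian.map_eq_gaussianReal,
      ContinuousLinearMap.integral_comp_id_comm IsGaussian.integrable_id]
    simp
  exact hmap.fun_comp hX

/-! ### Entries of the covariance matrix from the precision matrix. -/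

section Matrix

open Matrix.Norms.L2Operator

variable {d : ℕ}

theorem Matrix.abs_apply_le_l2_opNorm (A : Matrix (Fin d) (Fin d) ℝ) (i j : Fin d) :
    |A i j| ≤ ‖A‖ := by
  have h1 : ((Matrix.toEuclideanCLM (n := Fin d) (𝕜 := ℝ) A) (EuclideanSpace.single j 1)) i
      = A i j := by
    rw [Matrix.ofLp_toEuclideanCLM]
    simp
  rw [← h1, ← Matrix.l2_opNorm_toEuclideanCLM, ← Real.norm_eq_abs]
  refine (PiLp.norm_apply_le _ i).trans ?_
  refine (ContinuousLinearMap.le_opNorm _ _).trans ?_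
  simp

/-- Only an inequality, because the norm is `0` when `d = 0`. -/
theorem Matrix.l2_opNorm_one_le : ‖(1 : Matrix (Fin d) (Fin d) ℝ)‖ ≤ 1 := by
  rw [← Matrix.l2_opNorm_toEuclideanCLM, map_one]
  exact ContinuousLinearMap.norm_id_le

variable {S B : Matrix (Fin d) (Fin d) ℝ} {δ : ℝ}

theorem l2_opNorm_le_of_mul_one_add_eq_one (h : S * (1 + B) = 1) (hB : ‖B‖ ≤ δ) (hδ : δ < 1) :
    ‖S‖ ≤ 1 / (1 - δ) := by
  have h1 : S = 1 - S * B := by rw [eq_sub_iff_add_eq, ← h]; noncomm_ring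
  have h2 : ‖S‖ ≤ 1 + ‖S‖ * δ := by
    calc ‖S‖ = ‖1 - S * B‖ := by rw [← h1]
      _ ≤ ‖(1 : Matrix (Fin d) (Fin d) ℝ)‖ + ‖S * B‖ := norm_sub_le _ _
      _ ≤ 1 + ‖S‖ * ‖B‖ := add_le_add Matrix.l2_opNorm_one_le (norm_mul_le _ _)
      _ ≤ 1 + ‖S‖ * δ := by gcongr
  rw [le_div_iff₀ (by linarith)]
  linarith

theorem abs_apply_le_of_mul_one_add_eq_one (h : S * (1 + B) = 1) (hB : ‖B‖ ≤ δ) (hδ : δ < 1)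
    {i j : Fin d} (hij : i ≠ j) : |S i j| ≤ δ / (1 - δ) := by
  have h1 : S = 1 - S * B := by rw [eq_sub_iff_add_eq, ← h]; noncomm_ring
  have h2 : |S i j| = |(S * B) i j| := by
    conv_lhs => rw [h1]
    simp [Matrix.sub_apply, Matrix.one_apply_ne hij]
  have hδ' : 0 < 1 - δ := by linarith
  rw [h2]
  calc |(S * B) i j| ≤ ‖S * B‖ := Matrix.abs_apply_le_l2_opNorm _ _ _
    _ ≤ ‖S‖ * ‖B‖ := norm_mul_le _ _
    _ ≤ 1 / (1 - δ) * δ := by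
        gcongr
        exact l2_opNorm_le_of_mul_one_add_eq_one h hB hδ
    _ = δ / (1 - δ) := by ring

theorem abs_apply_self_sub_one_le_of_mul_one_add_eq_one (h : S * (1 + B) = 1) (hB : ‖B‖ ≤ δ)
    (hδ : δ < 1) (hdiag : ∀ i, B i i = 0) (i : Fin d) : |S i i - 1| ≤ (δ / (1 - δ)) ^ 2 := by
  have h1 : S = 1 - S * B := by rw [eq_sub_iff_add_eq, ← h]; noncomm_ring
  have h2 : S = 1 - B + S * B * B := by
    have : S * B = (1 - S * B) * B := by rw [← h1]
    calc S = 1 - S * B := h1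
      _ = 1 - (1 - S * B) * B := by rw [← this]
      _ = _ := by noncomm_ring
  have h3 : S i i - 1 = (S * B * B) i i := by
    conv_lhs => rw [h2]
    simp [Matrix.sub_apply, Matrix.add_apply, hdiag]
  have hδ' : 0 < 1 - δ := by linarith
  have hδ0 : 0 ≤ δ := (norm_nonneg _).trans hB
  rw [h3]
  calc |(S * B * B) i i| ≤ ‖S * B * B‖ := Matrix.abs_apply_le_l2_opNorm _ _ _
    _ ≤ ‖S‖ * ‖B‖ * ‖B‖ := (norm_mul_le _ _).trans (by gcongr; exact norm_mul_le _ _)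
    _ ≤ 1 / (1 - δ) * δ * δ := by
        gcongr
        exact l2_opNorm_le_of_mul_one_add_eq_one h hB hδ
    -- The extra factor, at least one, only serves to produce the square of `ε`.
    _ ≤ 1 / (1 - δ) * δ * δ * (1 / (1 - δ)) := by
        refine le_mul_of_one_le_right (by positivity) ?_
        rw [le_div_iff₀ hδ']
        linarith
    _ = (δ / (1 - δ)) ^ 2 := by ring

end Matrix

/-! ### Combining the expansion with the matrix bounds. -/

theorem derivSeries_eq_evenStepSeries (f : ℝ → ℝ) (k : ℕ) (x : ℝ) :
    derivSeries f k x = evenStepSeries (fun n => iteratedDeriv n f 0) k x := rfl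

theorem iteratedDeriv_two_mul_zero_of_odd {f : ℝ → ℝ} (hf : f.Odd) (k : ℕ) :
    iteratedDeriv (2 * k) f 0 = 0 := by
  have h1 := iteratedDeriv_comp_neg (2 * k) f 0
  have h2 : (fun x => f (-x)) = fun x => -f x := funext hf
  rw [h2, iteratedDeriv_fun_neg, neg_zero, pow_mul] at h1
  simp only [even_two, Even.neg_pow, one_pow, one_smul] at h1
  linarith

/-- The third order estimate for the covariance of `f (X)` and `f (Y)` when the variances of `X` and
`Y` are within `ε ^ 2` of one and the covariance is at most `ε`. -/
theorem IsCenteredGaussianPair.abs_integral_mul_sub_sq_mul_le {Ω : Type*} [MeasurableSpace Ω]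
    {P : Measure Ω} {X Y : Ω → ℝ} {a b s N ε E K : ℝ} {c : ℕ → ℝ} {f : ℝ → ℝ}
    (h : IsCenteredGaussianPair P X Y a b s) (hc : ∀ k, |c k| ≤ N) (hodd : ∀ k, c (2 * k) = 0)
    (hf : ∀ x, HasSum (fun k : ℕ => c k / (k ! : ℝ) * x ^ k) (f x))
    (hs : |s| ≤ ε) (ha : |a - 1| ≤ ε ^ 2) (hb : |b - 1| ≤ ε ^ 2) (hE : ε ≤ E)
    (haK : |a / 2| ≤ K) (hbK : |b / 2| ≤ K) (hK : 1 / 2 ≤ K) :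
    |∫ ω, f (X ω) * f (Y ω) ∂P - evenStepSeries c 1 (1 / 2) ^ 2 * s| ≤
      (N ^ 2 * Real.exp K ^ 2 * (Real.exp E + 1)) * ε ^ 3 := by
  have hN : 0 ≤ N := (abs_nonneg _).trans (hc 0)
  have hε : 0 ≤ ε := (abs_nonneg _).trans hs
  have h1 : |∫ ω, f (X ω) * f (Y ω) ∂P -
      s * (evenStepSeries c 1 (a / 2) * evenStepSeries c 1 (b / 2))| ≤
      ε ^ 3 * (N * Real.exp K) * (N * Real.exp K) * Real.exp E :=
    (h.abs_integral_mul_sub_le hc hodd hf).trans (by gcongr; exact hs.trans hE)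
  have hK' : |(1 / 2 : ℝ)| ≤ K := by rwa [abs_of_pos (by norm_num)]
  have hA : |evenStepSeries c 1 (a / 2)| ≤ N * Real.exp K :=
    (norm_evenStepSeries_le hc 1 _).trans (by gcongr)
  have hI : |evenStepSeries c 1 (1 / 2)| ≤ N * Real.exp K :=
    (norm_evenStepSeries_le hc 1 _).trans (by gcongr)
  have hdist : ∀ z : ℝ, |z - 1| ≤ ε ^ 2 → |z / 2| ≤ K →
      |evenStepSeries c 1 (z / 2) - evenStepSeries c 1 (1 / 2)| ≤
        N * (ε ^ 2 / 2) * Real.exp K := by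
    intro z hz hzK
    refine (norm_evenStepSeries_sub_le hc 1 hzK hK').trans ?_
    rw [← sub_div, abs_div, abs_two]
    gcongr
  have hdA := hdist a ha haK
  have hdB := hdist b hb hbK
  generalize evenStepSeries c 1 (a / 2) = A at *
  generalize evenStepSeries c 1 (b / 2) = B at *
  generalize evenStepSeries c 1 (1 / 2) = I at *
  generalize (∫ ω, f (X ω) * f (Y ω) ∂P) = T at *
  have h2 : |s * (A * B) - I ^ 2 * s| ≤ ε * ((N * Real.exp K) * (N * (ε ^ 2 / 2) * Real.exp K) +
      (N * Real.exp K) * (N * (ε ^ 2 / 2) * Real.exp K)) := by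
    have : s * (A * B) - I ^ 2 * s = s * (A * (B - I) + I * (A - I)) := by ring
    rw [this, abs_mul]
    gcongr
    refine (abs_add_le _ _).trans ?_
    rw [abs_mul, abs_mul]
    gcongr
  have h3 : |T - I ^ 2 * s| ≤ |T - s * (A * B)| + |s * (A * B) - I ^ 2 * s| := by
    have : T - I ^ 2 * s = (T - s * (A * B)) + (s * (A * B) - I ^ 2 * s) := by ring
    rw [this]
    exact abs_add_le _ _
  refine h3.trans ((add_le_add h1 h2).trans (le_of_eq ?_))
  ring

theorem mainTheorem4 (N δ₀ : ℝ) (hδ₀ : δ₀ < 1) :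
    ∃ C : ℝ, ∀ (f : ℝ → ℝ), f.Odd →
      (∀ x : ℝ, HasSum (fun k : ℕ => iteratedDeriv k f 0 / (k ! : ℝ) * x ^ k) (f x)) →
      (∀ k : ℕ, |iteratedDeriv k f 0| ≤ N) →
      Summable (fun u : ℕ => iteratedDeriv (2 * u + 1) f 0 / (u ! : ℝ) * (1 / 2 : ℝ) ^ u) ∧
      ∀ (d : ℕ) (S B : Matrix (Fin d) (Fin d) ℝ) (δ : ℝ),
        S.PosDef → S⁻¹ = 1 + B → (∀ i, B i i = 0) → euclideanOpNorm B ≤ δ → δ ≤ δ₀ →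
        ∀ {Ω : Type*} [MeasurableSpace Ω] (P : Measure Ω) [IsProbabilityMeasure P]
          (X : Ω → EuclideanSpace ℝ (Fin d)), HasLaw X (multivariateGaussian 0 S) P →
          (∀ i, MemLp (fun ω => f (X ω i)) 2 P) ∧
          ∀ i j, i ≠ j →
            |transformedCov P X f i j - derivSeries f 1 (1 / 2) ^ 2 * S i j|
              ≤ C * (δ / (1 - δ)) ^ 3 := by
  -- Here `1 / (1 - δ₀)` bounds the half-variances and `1/2`, and `δ₀ / (1 - δ₀)` bounds `ε`.
  refine ⟨N ^ 2 * Real.exp (1 / (1 - δ₀)) ^ 2 * (Real.exp (δ₀ / (1 - δ₀)) + 1),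
    fun f hodd hf hc => ⟨?_, ?_⟩⟩
  · exact (summable_norm_coeff_div_factorial_mul_pow (c := fun n => iteratedDeriv n f 0) hc
      (fun u => 2 * u + 1) (1 / 2)).of_norm
  intro d S B δ hS hSB hdiag hB hδ Ω _ P _ X hX
  have hpair := isCenteredGaussianPair_of_hasLaw_multivariateGaussian hS.posSemidef hX
  have hmem : ∀ i, MemLp (fun ω => f (X ω i)) 2 P := fun i =>
    memLp_two_comp_of_hasLaw_gaussianReal (hpair i i).hasLaw_left hc hf
  refine ⟨hmem, fun i j hij => ?_⟩
  have hmean : ∀ i, ∫ ω, f (X ω i) ∂P = 0 := fun i =>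
    integral_odd_comp_of_hasLaw_gaussianReal (hpair i i).hasLaw_left (measurable_of_hasSum_pow hf)
      hodd
  have hcov : transformedCov P X f i j = ∫ ω, f (X ω i) * f (X ω j) ∂P := by
    simp only [transformedCov, Matrix.of_apply]
    rw [covariance_eq_sub (hmem i) (hmem j), hmean, zero_mul, sub_zero]
    rfl
  rw [hcov, derivSeries_eq_evenStepSeries]
  have hδ1 : δ < 1 := hδ.trans_lt hδ₀
  have hδ0 : 0 ≤ δ := (norm_nonneg _).trans hB
  have hpos : 0 < 1 - δ := by linarith
  have hpos₀ : 0 < 1 - δ₀ := by linarith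
  have hmul : S * (1 + B) = 1 := by
    rw [← hSB]
    exact Matrix.mul_nonsing_inv S ((Matrix.isUnit_iff_isUnit_det S).1 hS.isUnit)
  have hdiagK : ∀ k, |S k k / 2| ≤ 1 / (1 - δ₀) := by
    intro k
    have h1 := (Matrix.abs_apply_le_l2_opNorm S k k).trans
      (l2_opNorm_le_of_mul_one_add_eq_one hmul hB hδ1)
    have h2 : 1 / (1 - δ) ≤ 1 / (1 - δ₀) := by gcongr
    rw [abs_div, abs_two]
    linarith [abs_nonneg (S k k)]
  refine (hpair i j).abs_integral_mul_sub_sq_mul_le hc (iteratedDeriv_two_mul_zero_of_odd hodd) hf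
    (abs_apply_le_of_mul_one_add_eq_one hmul hB hδ1 hij)
    (abs_apply_self_sub_one_le_of_mul_one_add_eq_one hmul hB hδ1 hdiag i)
    (abs_apply_self_sub_one_le_of_mul_one_add_eq_one hmul hB hδ1 hdiag j) ?_
    (hdiagK i) (hdiagK j) ?_
  · gcongr
    exact hδ0.trans hδ
  · rw [le_div_iff₀ hpos₀]
    linarith
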